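/- **Setting.** Let $d\in\mathbb N$, $T>0$, $\mathbb T^d=\mathbb R^d/\mathbb Z^d$ with its flat distance, and let $\mathcal P(\mathbb T^d)$ be the set of Borel probability measures on $\mathbb T^d$, with the topology of weak convergence. Let $\mathbf d_1(\mu,\nu)=\sup_h\int h\,d(\mu-\nu)$, the supremum being over the $1$-Lipschitz maps $h:\mathbb T^d\to\mathbb R$. We are given: * $m_0\in\mathcal P(\mathbb T^d)$ with a smooth density; * $H\in C^2(\mathbb T^d\times\mathbb R^d)$ such that, for some constant $c>0$ and all $(x,p)$, $\frac1c I_d\le D^2_{pp}H(x,p)\le c\,I_d$ and $\langle D_xH(x,p),p\rangle\ge -c(|p|^2+1)$. Set $H^*(x,q)=\sup_{p}\langle p,q\rangle-H(x,p)$ and $L(x,v)=H^*(x,-v)$; * $f,g:\mathbb T^d\times\mathcal P(\mathbb T^d)\to\mathbb R$ such that $m\mapsto f(\cdot,m)$ is Lipschitz continuous from $(\mathcal P(\mathbb T^d),\mathbf d_1)$ to $C^2(\mathbb T^d)$ and $m\mapsto g(\cdot,m)$ is Lipschitz continuous from $(\mathcal P(\mathbb T^d),\mathbf d_1)$ to $C^3(\mathbb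 T^d)$; * continuous maps $F,G:\mathcal P(\mathbb T^d)\to\mathbb R$ with $f=\frac{\delta F}{\delta m}$ and $g=\frac{\delta G}{\delta m}$, that is, $f,g$ are continuous and for all $m,m'$ $$\lim_{s\to0^+}\frac{F((1-s)m+sm')-F(m)}{s}=\int_{\mathbb T^d} f(x,m)\,d(m'-m)(x),$$ and likewise for $G$ and $g$. Let $\Gamma=C^0([0,T],\mathbb T^d)$ with the topology of uniform convergence, $e_t(\gamma)=\gamma(t)$, and let $\mathcal P(\Gamma)$ be the set of Borel probability measures on $\Gamma$. For $\eta\in\mathcal P(\Gamma)$ and $\gamma\in\Gamma$ let $$J(\gamma(0),\gamma,\eta)=\int_0^T \big(L(\gamma(s),\dot\gamma(s))+f(\gamma(s),e_s\#\eta)\big)ds+g(\gamma(T),e_T\#\eta)$$ if $\gamma\in H^1([0,T],\mathbb T^d)$, and $J(\gamma(0),\gamma,\eta)=+\infty$ otherwise. Let $$\Phi(\eta)=\int_\Gamma\int_0^T L(\gamma(t),\dot\gamma(t))\,dt\,d\eta(\gamma)+\int_0^T F(e_t\#\eta)\,dt+G(e_T\#\eta)\in(-\infty,+\infty],$$ where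 the inner integral is $+\infty$ if $\gamma\notin H^1$. For $\eta,\eta'\in\mathcal P(\Gamma)$ at which $\Phi$ is finite let $$\frac{\delta\Phi}{\delta\eta}(\eta)(\eta'-\eta)=\lim_{s\to0^+}\frac{\Phi((1-s)\eta+s\eta')-\Phi(\eta)}{s}.$$ **Fictitious play.** Let $\eta^0\in\mathcal P(\Gamma)$ with $e_0\#\eta^0=m_0$. For $n\ge0$, let $x\mapsto\bar\gamma^{n+1}_x\in\Gamma$ be a Borel map such that, for every $x\in\mathbb T^d$, $\bar\gamma_x^{n+1}\in H^1$ minimizes $J(x,\cdot,\eta^n)$ among the curves $\gamma\in H^1([0,T],\mathbb T^d)$ with $\gamma(0)=x$, and set $$\theta^{n+1}=\bar\gamma^{n+1}_\cdot\#m_0,\qquad \eta^{n+1}=\frac1{n+1}\sum_{k=1}^{n+1}\theta^k .$$ **Proposition 3.5.** There is a constant $C>0$, depending only on the data $d,T,H,f,g,F,G,m_0$ (not on $\eta^0$, on the choice of the optimal curves, or on $n$), such that for every such sequence and every $n\ge1$: $\Phi$ is finite at $\eta^n$ and at $\theta^{n+1}$, the derivative $\frac{\delta\Phi}{\delta\eta}(\eta^n)(\theta^{n+1}-\eta^n)$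 exists and is finite, $$\Phi(\eta^{n+1})\le\Phi(\eta^n)+\frac1{n+1}\,\frac{\delta\Phi}{\delta\eta}(\eta^n)(\theta^{n+1}-\eta^n)+\frac{C}{(n+1)^2},$$ and $$\frac{\delta\Phi}{\delta\eta}(\eta^n)(\theta^{n+1}-\eta^n)=\int_\Gamma J(\gamma(0),\gamma,\eta^n)\,d\theta^{n+1}(\gamma)-\int_\Gamma J(\gamma(0),\gamma,\eta^n)\,d\eta^n(\gamma)\le0,$$ both integrals being finite. -/

import Mathlib

open MeasureTheory Filter Topology
open scoped ENNReal ContDiff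

noncomputable section

namespace MFG

/-- The Euclidean space `ℝ^d`. -/
abbrev E (d : ℕ) : Type := EuclideanSpace ℝ (Fin d)

/-- The flat torus `𝕋^d = ℝ^d / ℤ^d`, with its flat (Euclidean quotient) distance. -/
abbrev Torus (d : ℕ) : Type := PiLp 2 (fun _ : Fin d => UnitAddCircle)

/-- The canonical projection `ℝ^d → 𝕋^d`. -/
def proj {d : ℕ} (y : E d) : Torus d := WithLp.toLp 2 (fun i => (y i : UnitAddCircle))

/-- The Lebesgue (Haar probability) measure of the torus. -/
def torusVolume (d : ℕ) : Measure (Torus d) :=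
  Measure.map (WithLp.toLp 2) (volume : Measure (Fin d → UnitAddCircle))

/-- The Borel probability measures on the torus (with the topology of weak convergence). -/
abbrev PTorus (d : ℕ) : Type := ProbabilityMeasure (Torus d)

/-- The Kantorovich distance `d₁(μ, ν) = sup_h ∫ h d(μ - ν)`, over the `1`-Lipschitz maps `h`. -/
def dOne {d : ℕ} (μ ν : PTorus d) : ℝ :=
  sSup {r : ℝ | ∃ h : Torus d → ℝ, LipschitzWith 1 h ∧
    r = ∫ x, h x ∂(μ : Measure (Torus d)) - ∫ x, h x ∂(ν : Measure (Torus d))}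

/-! ### Derivatives on spaces of probability measures -/

/-- The convex combination `(1 - s) μ + s ν` of two probability measures. -/
def mix {X : Type*} [MeasurableSpace X] (s : unitInterval) (μ ν : ProbabilityMeasure X) :
    ProbabilityMeasure X :=
  ⟨ENNReal.ofReal (1 - s) • (μ : Measure X) + ENNReal.ofReal s • (ν : Measure X), ⟨by
    have h0 : (0 : ℝ) ≤ 1 - s := by linarith [s.2.2]
    have h1 : (0 : ℝ) ≤ s := s.2.1
    simp only [Measure.coe_add, Measure.coe_smul, Pi.add_apply, Pi.smul_apply, measure_univ,
      smul_eq_mul, mul_one]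
    rw [← ENNReal.ofReal_add h0 h1]
    simp⟩⟩

/-- `f = δF/δm`: `F` and `f` are continuous and, for all `m`, `m'`,
`((F ((1 - s) m + s m') - F m) / s) → ∫ f(x, m) d(m' - m)(x)` as `s → 0⁺`.
(No normalization of the additive constant of `f(·, m)` is required.) -/
structure IsMeasureDeriv {d : ℕ} (F : PTorus d → ℝ) (f : Torus d → PTorus d → ℝ) : Prop where
  continuous_potential : Continuous F
  continuous_deriv : Continuous (fun z : Torus d × PTorus d => f z.1 z.2)
  tendsto : ∀ m m' : PTorus d,
    Tendsto (fun s : unitInterval => (F (mix s m m') - F m) / (s : ℝ)) (𝓝[>] 0)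
      (𝓝 (∫ x, f x m ∂(m' : Measure (Torus d)) - ∫ x, f x m ∂(m : Measure (Torus d))))

/-- `δΨ/δη(η)(η' - η) = D` for a functional `Ψ` with values in `(-∞, +∞]`: `Ψ` is finite at `η`
and at `η'`, and the difference quotients of `Ψ` at `η` along the segment towards `η'` converge to
the real number `D`. -/
structure HasDerivTowards {X : Type*} [MeasurableSpace X] (Ψ : ProbabilityMeasure X → EReal)
    (η η' : ProbabilityMeasure X) (D : ℝ) : Prop where
  finite_left : Ψ η ≠ ⊥ ∧ Ψ η ≠ ⊤
  finite_right : Ψ η' ≠ ⊥ ∧ Ψ η' ≠ ⊤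
  tendsto : Tendsto (fun s : unitInterval => (Ψ (mix s η η') - Ψ η) / ((s : ℝ) : EReal))
    (𝓝[>] 0) (𝓝 (D : EReal))

/-! ### Assumptions on the data -/

/-- `m₀` has a smooth density with respect to the Lebesgue measure. -/
def HasSmoothDensity {d : ℕ} (m₀ : PTorus d) : Prop :=
  ∃ ρ : Torus d → ℝ, ContDiff ℝ ∞ (fun y : E d => ρ (proj y)) ∧ (∀ x, 0 ≤ ρ x) ∧
    (m₀ : Measure (Torus d)) = (torusVolume d).withDensity (fun x => ENNReal.ofReal (ρ x))

/-- `H ∈ C²(𝕋^d × ℝ^d)`, `(1/C) I ≤ D²_{pp} H ≤ C I`, `⟨D_x H(x, p), p⟩ ≥ - C (|p|² + 1)`. -/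
structure IsAdmissibleHamiltonian {d : ℕ} (H : Torus d → E d → ℝ) : Prop where
  contDiff : ContDiff ℝ 2 (fun z : E d × E d => H (proj z.1) z.2)
  hessian : ∃ C : ℝ, 0 < C ∧ ∀ (x : Torus d) (p v : E d),
    1 / C * ‖v‖ ^ 2 ≤ fderiv ℝ (fderiv ℝ (H x)) p v v ∧
    fderiv ℝ (fderiv ℝ (H x)) p v v ≤ C * ‖v‖ ^ 2
  space_deriv : ∃ C : ℝ, ∀ y p : E d,
    -C * (‖p‖ ^ 2 + 1) ≤ fderiv ℝ (fun y' : E d => H (proj y') p) y p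

/-- `m ↦ f(·, m)` is Lipschitz continuous from `(P(𝕋^d), d₁)` to `C^k(𝕋^d)`. -/
structure IsLipschitzIntoCk {d : ℕ} (k : ℕ) (f : Torus d → PTorus d → ℝ) : Prop where
  contDiff : ∀ m : PTorus d, ContDiff ℝ k (fun y : E d => f (proj y) m)
  lipschitz : ∃ K : ℝ, ∀ (m m' : PTorus d) (i : ℕ), i ≤ k → ∀ y : E d,
    ‖iteratedFDeriv ℝ i (fun y' : E d => f (proj y') m - f (proj y') m') y‖ ≤ K * dOne m m'

/-! ### Curves -/

/-- The space `Γ = C⁰([0, T], 𝕋^d)`, with the topology of uniform convergence. -/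
abbrev Curve (d : ℕ) (T : ℝ) : Type := C(Set.Icc (0 : ℝ) T, Torus d)

instance (d : ℕ) (T : ℝ) : MeasurableSpace (Curve d T) := borel _

instance (d : ℕ) (T : ℝ) : BorelSpace (Curve d T) := ⟨rfl⟩

/-- The Lebesgue measure on `[0, T]`. -/
def timeMeasure (T : ℝ) : Measure (Set.Icc (0 : ℝ) T) := Measure.comap Subtype.val volume

/-- The time `0` of `[0, T]`. -/
def startTime {T : ℝ} (hT : 0 < T) : Set.Icc (0 : ℝ) T := ⟨0, le_rfl, hT.le⟩

/-- The time `T` of `[0, T]`. -/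
def endTime {T : ℝ} (hT : 0 < T) : Set.Icc (0 : ℝ) T := ⟨T, hT.le, le_rfl⟩

/-- `m^η(t) = e_t # η`, the push-forward of `η` by the evaluation at time `t`. -/
def marginal {d : ℕ} {T : ℝ} (η : ProbabilityMeasure (Curve d T)) (t : Set.Icc (0 : ℝ) T) :
    PTorus d :=
  η.map (f := fun γ : Curve d T => γ t)
    (continuous_eval_const t).measurable.aemeasurable

/-- `v ∈ L²([0, T], ℝ^d)` and `γ(t) = γ(0) + ∫₀ᵗ v` modulo `ℤ^d` for all `t`: that is, `γ` is in
`H¹([0, T], 𝕋^d)`, with time derivative `v` (which `γ` determines almost everywhere). -/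
def IsVelocity {d : ℕ} {T : ℝ} (hT : 0 < T) (γ : Curve d T) (v : Set.Icc (0 : ℝ) T → E d) : Prop :=
  MemLp v 2 (timeMeasure T) ∧
    ∀ t, γ t = γ (startTime hT) + proj (∫ s in Set.Iic t, v s ∂(timeMeasure T))

/-- `γ ∈ H¹([0, T], 𝕋^d)`. -/
def IsHOne {d : ℕ} {T : ℝ} (hT : 0 < T) (γ : Curve d T) : Prop := ∃ v, IsVelocity hT γ v

open Classical in
/-- The time derivative of a curve in `H¹` (and `0` for the other curves, where it is not used). -/
def velocity {d : ℕ} {T : ℝ} (hT : 0 < T) (γ : Curve d T) : Set.Icc (0 : ℝ) T → E d :=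
  if h : IsHOne hT γ then h.choose else 0

/-! ### Costs and potential -/

/-- The Fenchel conjugate `H*(x, q) = sup_p ⟨p, q⟩ - H(x, p)` of `H` in the second variable. -/
def conjugate {d : ℕ} (H : Torus d → E d → ℝ) (x : Torus d) (q : E d) : ℝ :=
  ⨆ p : E d, (inner ℝ p q - H x p)

/-- The Lagrangian `L(x, v) = H*(x, -v)`. -/
def lagrangian {d : ℕ} (H : Torus d → E d → ℝ) (x : Torus d) (v : E d) : ℝ := conjugate H x (-v)

open Classical in
/-- The cost `J(γ(0), γ, η)` of the curve `γ` (on the whole interval `[0, T]`) when the repartition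
of strategies is `η`; it is `+∞` if `γ ∉ H¹`. -/
def J {d : ℕ} {T : ℝ} (hT : 0 < T) (H : Torus d → E d → ℝ) (f g : Torus d → PTorus d → ℝ)
    (η : ProbabilityMeasure (Curve d T)) (γ : Curve d T) : EReal :=
  if IsHOne hT γ then
    (((∫ s, (lagrangian H (γ s) (velocity hT γ s) + f (γ s) (marginal η s)) ∂(timeMeasure T))
      + g (γ (endTime hT)) (marginal η (endTime hT)) : ℝ) : EReal)
  else ⊤

open Classical in
/-- The kinetic cost `∫₀ᵀ L(γ, γ')` of a curve; it is `+∞` if `γ ∉ H¹`. -/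
def kineticCost {d : ℕ} {T : ℝ} (hT : 0 < T) (H : Torus d → E d → ℝ) (γ : Curve d T) : EReal :=
  if IsHOne hT γ then
    ((∫ s, lagrangian H (γ s) (velocity hT γ s) ∂(timeMeasure T) : ℝ) : EReal)
  else ⊤

/-- The integral `∫ g dμ = ∫ g⁺ dμ - ∫ g⁻ dμ` of an extended-real-valued function; it is used for
functions that are bounded below and finite measures, where it takes its values in `(-∞, +∞]`. -/
def integralE {X : Type*} [MeasurableSpace X] (μ : Measure X) (g : X → EReal) : EReal :=
  ((∫⁻ x, (g x).toENNReal ∂μ : ℝ≥0∞) : EReal) - ((∫⁻ x, (-(g x)).toENNReal ∂μ : ℝ≥0∞) : EReal)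

/-- The potential
`Φ(η) = ∫_Γ ∫₀ᵀ L(γ, γ') dt dη(γ) + ∫₀ᵀ F(e_t # η) dt + G(e_T # η) ∈ (-∞, +∞]`. -/
def potential {d : ℕ} {T : ℝ} (hT : 0 < T) (H : Torus d → E d → ℝ) (F G : PTorus d → ℝ)
    (η : ProbabilityMeasure (Curve d T)) : EReal :=
  integralE (η : Measure (Curve d T)) (kineticCost hT H)
    + (((∫ t, F (marginal η t) ∂(timeMeasure T)) + G (marginal η (endTime hT)) : ℝ) : EReal)

/-! ### The fictitious play -/

/-- `γ` minimizes `J(x, ·, η)` among the curves in `H¹` that start from `x`. -/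
structure IsOptimal {d : ℕ} {T : ℝ} (hT : 0 < T) (H : Torus d → E d → ℝ)
    (f g : Torus d → PTorus d → ℝ) (η : ProbabilityMeasure (Curve d T)) (x : Torus d)
    (γ : Curve d T) : Prop where
  isHOne : IsHOne hT γ
  start : γ (startTime hT) = x
  le : ∀ γ' : Curve d T, IsHOne hT γ' → γ' (startTime hT) = x → J hT H f g η γ ≤ J hT H f g η γ'

/-- `(η^n)_{n ≥ 0}` and `(θ^n)_{n ≥ 1}` are produced by the fictitious play: `e_0 # η^0 = m₀`,
`θ^{n+1}` is the image of `m₀` by a Borel selection `x ↦ γ_x` of optimal curves against `η^n`, and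
`η^{n+1}` is the average of `θ^1, …, θ^{n+1}`. (The value of `θ` at `0` is irrelevant.) -/
structure IsFictitiousPlay {d : ℕ} {T : ℝ} (hT : 0 < T) (H : Torus d → E d → ℝ)
    (f g : Torus d → PTorus d → ℝ) (m₀ : PTorus d)
    (η θ : ℕ → ProbabilityMeasure (Curve d T)) : Prop where
  initial : marginal (η 0) (startTime hT) = m₀
  bestResponse : ∀ n : ℕ, ∃ γ : Torus d → Curve d T, Measurable γ ∧
    (∀ x, IsOptimal hT H f g (η n) x (γ x)) ∧
    (θ (n + 1) : Measure (Curve d T)) = Measure.map γ (m₀ : Measure (Torus d))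
  belief : ∀ n : ℕ, (η (n + 1) : Measure (Curve d T)) =
    ((n + 1 : ℕ) : ℝ≥0∞)⁻¹ • ∑ k ∈ Finset.Icc 1 (n + 1), (θ k : Measure (Curve d T))

end MFG

end

noncomputable section

namespace MFG

/-! ### Coercivity of the Hamiltonian and regularity of its Lagrangian. -/

section TorusLagrangian

variable {d : ℕ}

/-! ### The torus -/

/-! The kinetic part of `Φ` is affine in `η`, so only `F` and `G` contribute a remainder along a
segment. On the segment from `m` to `m'`, the right derivative of `F` at parameter `r` is the
pairing of `f(·, m_r)` with `m' - m`. Since `d₁(m_r, m) ≤ 2 r diam` and `f` is Lipschitz in `d₁`,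
this derivative moves by `O(r)`, whence a remainder `O(s²)` uniform in `m`, `m'`
(`IsMeasureDeriv.exists_expansion`). Integrating in time and applying Fubini gives the expansion of
`Φ`, whose linear coefficient is the difference of the integrals of `J`
(`exists_expansion_realPotential`). Letting `s → 0` gives the derivative; taking `s = 1/(n+1)`, for
which the mixture is the next belief (`belief_succ`), gives the inequality.

The sign comes from optimality: for `n ≥ 1` the belief is an average of images of the same `m₀`
under selections of `H¹` curves starting at `x`, and the best response beats each of them pointwise
in `x` (`realCost_response_le`).

The delicate point is that the kinetic integrals make sense, as measurability of the kinetic cost on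
the space of curves is not established. A Borel selection is injective, hence a measurable
embedding, so it is enough to work on the torus. There the value function is upper semicontinuous,
because translating an optimal curve gives a competitor for nearby starting points; subtracting the
continuous coupling cost leaves a measurable kinetic cost, and compactness bounds it
(`integrable_realKinetic_optimal`). -/

instance compactSpace_torus (d : ℕ) : CompactSpace (Torus d) :=
  (PiLp.homeomorph 2 (fun _ : Fin d => UnitAddCircle)).symm.compactSpace

theorem isOpenQuotientMap_proj : IsOpenQuotientMap (proj (d := d)) := by
  have h1 : IsOpenQuotientMap (Pi.map (fun (_ : Fin d) (y : ℝ) => (y : UnitAddCircle))) :=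
    IsOpenQuotientMap.piMap fun _ => QuotientAddGroup.isOpenQuotientMap_mk
  exact ((PiLp.homeomorph 2 (fun _ : Fin d => UnitAddCircle)).symm.isOpenQuotientMap.comp h1).comp
    (PiLp.homeomorph 2 (fun _ : Fin d => ℝ)).isOpenQuotientMap

/-! ### The Hamiltonian and the Lagrangian -/

variable {H : Torus d → E d → ℝ}

theorem IsAdmissibleHamiltonian.continuous_uncurry (hH : IsAdmissibleHamiltonian H) :
    Continuous (Function.uncurry H) := by
  have hq : IsOpenQuotientMap (Prod.map (proj (d := d)) (id : E d → E d)) :=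
    isOpenQuotientMap_proj.prodMap IsOpenQuotientMap.id
  exact hq.isQuotientMap.continuous_iff.2 hH.contDiff.continuous

theorem IsAdmissibleHamiltonian.contDiff_momentum (hH : IsAdmissibleHamiltonian H) (x : Torus d) :
    ContDiff ℝ 2 (H x) := by
  obtain ⟨y, rfl⟩ := isOpenQuotientMap_proj.surjective x
  exact hH.contDiff.comp (contDiff_const.prodMk contDiff_id)

/-- A `C²` function on a line with second derivative at least `2 a` dominates a parabola. -/
theorem quadratic_lower_bound_of_deriv2 {φ φ' φ'' : ℝ → ℝ} {a t : ℝ}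
    (h1 : ∀ s, HasDerivAt φ (φ' s) s) (h2 : ∀ s, HasDerivAt φ' (φ'' s) s)
    (ha : ∀ s, 2 * a ≤ φ'' s) (ht : 0 ≤ t) :
    a * t ^ 2 + (1 + t) * φ 0 - t * (φ (-1) - a) ≤ φ t := by
  have hd1 : ∀ s, HasDerivAt (fun s => φ s - a * s ^ 2) (φ' s - 2 * a * s) s := fun s => by
    exact ((h1 s).sub ((hasDerivAt_pow 2 s).const_mul a)).congr_deriv (by norm_num; ring)
  have hd2 : ∀ s, HasDerivAt (fun s => φ' s - 2 * a * s) (φ'' s - 2 * a) s := fun s => by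
    exact ((h2 s).sub ((hasDerivAt_id s).const_mul (2 * a))).congr_deriv (by ring)
  have hderiv : deriv (fun s => φ s - a * s ^ 2) = fun s => φ' s - 2 * a * s :=
    funext fun s => (hd1 s).deriv
  have hconv : ConvexOn ℝ Set.univ (fun s => φ s - a * s ^ 2) := by
    refine convexOn_univ_of_deriv2_nonneg (fun s => (hd1 s).differentiableAt) ?_ ?_
    · rw [hderiv]; exact fun s => (hd2 s).differentiableAt
    · intro s
      simp only [Function.iterate_succ, Function.iterate_zero, Function.comp, id]
      rw [hderiv, (hd2 s).deriv]
      linarith [ha s]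
  have hpos : 0 < 1 + t := by linarith
  have hw0 : 0 ≤ 1 / (1 + t) := by positivity
  have hw1 : 0 ≤ t / (1 + t) := by positivity
  -- Convexity is used at `-1 < 0 ≤ t`, where `0` is the barycentre of `t` and `-1`. The bound then
  -- involves values of `φ` only, with no derivative at `0`.
  have := hconv.2 (Set.mem_univ t) (Set.mem_univ (-1)) hw0 hw1
    (by field_simp)
  have e : (1 / (1 + t)) • t + (t / (1 + t)) • (-1 : ℝ) = 0 := by
    simp only [smul_eq_mul]; field_simp; ring
  rw [e] at this
  simp only [smul_eq_mul] at this
  have h3 := mul_le_mul_of_nonneg_left this hpos.le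
  have e2 : (1 + t) * (1 / (1 + t) * (φ t - a * t ^ 2) + t / (1 + t) * (φ (-1) - a * (-1) ^ 2))
      = (φ t - a * t ^ 2) + t * (φ (-1) - a) := by field_simp
  rw [e2] at h3
  nlinarith

theorem IsAdmissibleHamiltonian.exists_bound_zero (hH : IsAdmissibleHamiltonian H) (r : ℝ) :
    ∃ M : ℝ, 0 ≤ M ∧ ∀ x p, ‖p‖ ≤ r → |H x p| ≤ M := by
  have hK : IsCompact ((Set.univ : Set (Torus d)) ×ˢ Metric.closedBall (0 : E d) r) :=
    isCompact_univ.prod (isCompact_closedBall 0 r)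
  obtain ⟨M, hM⟩ := hK.exists_bound_of_continuousOn hH.continuous_uncurry.continuousOn
  refine ⟨max M 0, le_max_right _ _, fun x p hp => ?_⟩
  exact (hM (x, p) ⟨Set.mem_univ _, by simpa using hp⟩).trans (le_max_left _ _)

/-- Along the ray through `p`, strong convexity gives a parabola whose lower-order terms depend on
`H` at `0` and `-p/‖p‖`; these are bounded uniformly in `x` by compactness. -/
theorem IsAdmissibleHamiltonian.coercive (hH : IsAdmissibleHamiltonian H) :
    ∃ a b : ℝ, 0 < a ∧ 0 ≤ b ∧ ∀ x p, a * ‖p‖ ^ 2 - b ≤ H x p := by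
  obtain ⟨C, hC, hess⟩ := hH.hessian
  obtain ⟨M, hM0, hM⟩ := hH.exists_bound_zero 1
  have ha : 0 < 1 / C / 2 := by positivity
  set a := 1 / C / 2 with ha'
  refine ⟨a / 2, M + 2 * M ^ 2 / a, by positivity, by positivity, fun x p => ?_⟩
  rcases eq_or_ne p 0 with rfl | hp
  · have := abs_le.1 (hM x 0 (by simp))
    have : 0 ≤ 2 * M ^ 2 / a := by positivity
    simp only [norm_zero]; linarith
  have hp' : 0 < ‖p‖ := norm_pos_iff.2 hp
  set e : E d := ‖p‖⁻¹ • p with he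
  have hne : ‖e‖ = 1 := by
    rw [he, norm_smul, norm_inv, norm_norm, inv_mul_cancel₀ hp'.ne']
  have hcd := hH.contDiff_momentum x
  have hline : ∀ s : ℝ, HasDerivAt (fun s : ℝ => s • e) e s := fun s => by
    simpa using (hasDerivAt_id s).smul_const e
  have h1 : ∀ s : ℝ, HasDerivAt (fun s : ℝ => H x (s • e)) (fderiv ℝ (H x) (s • e) e) s :=
    fun s => ((hcd.differentiable (by norm_num)) (s • e)).hasFDerivAt.comp_hasDerivAt s (hline s)
  have hcd' : ContDiff ℝ 1 (fderiv ℝ (H x)) := hcd.fderiv_right (by norm_num)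
  have h2 : ∀ s : ℝ, HasDerivAt (fun s : ℝ => fderiv ℝ (H x) (s • e) e)
      (fderiv ℝ (fderiv ℝ (H x)) (s • e) e e) s := fun s => by
    have h := ((hcd'.differentiable (by norm_num)) (s • e)).hasFDerivAt.comp_hasDerivAt s (hline s)
    exact h.clm_apply (hasDerivAt_const s e) |>.congr_deriv (by simp)
  have key := quadratic_lower_bound_of_deriv2 (a := a) h1 h2
    (fun s => by have := (hess x (s • e) e).1; rw [hne] at this; rw [ha']; linarith) hp'.le
  have hpe : ‖p‖ • e = p := by rw [he, smul_smul, mul_inv_cancel₀ hp'.ne', one_smul]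
  simp only [hpe, zero_smul] at key
  have b0 := abs_le.1 (hM x 0 (by simp))
  have b1 := abs_le.1 (hM x ((-1 : ℝ) • e) (by rw [norm_smul, hne]; simp))
  set t := ‖p‖
  have k1 : a * t ^ 2 - (1 + t) * M - t * M ≤ H x p := by nlinarith
  -- Young's inequality: half of the quadratic term absorbs the linear one.
  have k2 : 2 * t * M ≤ a / 2 * t ^ 2 + 2 * M ^ 2 / a := by
    have : a / 2 * t ^ 2 + 2 * M ^ 2 / a - 2 * t * M = (a * t - 2 * M) ^ 2 / (2 * a) := by
      field_simp; ring
    have : 0 ≤ (a * t - 2 * M) ^ 2 / (2 * a) := by positivity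
    linarith
  linarith

section Lagrangian

variable {a b : ℝ}

theorem conjugate_term_le (ha : 0 < a) (hco : ∀ x p, a * ‖p‖ ^ 2 - b ≤ H x p)
    (x : Torus d) (q p : E d) : inner ℝ p q - H x p ≤ ‖q‖ ^ 2 / (4 * a) + b := by
  have h1 : inner ℝ p q ≤ ‖p‖ * ‖q‖ := real_inner_le_norm p q
  have h2 := hco x p
  have : ‖q‖ ^ 2 / (4 * a) - ‖p‖ * ‖q‖ + a * ‖p‖ ^ 2 = (2 * a * ‖p‖ - ‖q‖) ^ 2 / (4 * a) := by
    field_simp; ring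
  have : 0 ≤ (2 * a * ‖p‖ - ‖q‖) ^ 2 / (4 * a) := by positivity
  linarith

theorem bddAbove_conjugate (ha : 0 < a) (hco : ∀ x p, a * ‖p‖ ^ 2 - b ≤ H x p)
    (x : Torus d) (q : E d) : BddAbove (Set.range fun p : E d => inner ℝ p q - H x p) :=
  ⟨_, by rintro _ ⟨p, rfl⟩; exact conjugate_term_le ha hco x q p⟩

end Lagrangian

/-- A pointwise bounded supremum of continuous functions is lower semicontinuous, which suffices for
composing with a merely measurable velocity. -/
theorem IsAdmissibleHamiltonian.measurable_lagrangian (hH : IsAdmissibleHamiltonian H) :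
    Measurable (Function.uncurry (lagrangian H)) := by
  obtain ⟨a, b, ha, -, hco⟩ := hH.coercive
  refine LowerSemicontinuous.measurable (lowerSemicontinuous_ciSup (ι := E d)
    (f := fun p (z : Torus d × E d) => inner ℝ p (-z.2) - H z.1 p) ?_ ?_)
  · exact fun z => bddAbove_conjugate ha hco z.1 (-z.2)
  · intro p
    refine Continuous.lowerSemicontinuous ?_
    have : Continuous fun z : Torus d × E d => H z.1 p :=
      hH.continuous_uncurry.comp (continuous_fst.prodMk continuous_const)
    exact (continuous_const.inner continuous_snd.neg).sub this

/-- Taking `p = 0` bounds the supremum below, and coercivity of `H` bounds it above. Quadratic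
growth is what makes the Lagrangian integrable along `H¹` curves. -/
theorem IsAdmissibleHamiltonian.lagrangian_bound (hH : IsAdmissibleHamiltonian H) :
    ∃ C : ℝ, 0 ≤ C ∧ ∀ x v, -C ≤ lagrangian H x v ∧ |lagrangian H x v| ≤ C * (1 + ‖v‖ ^ 2) := by
  obtain ⟨a, b, ha, hb, hco⟩ := hH.coercive
  obtain ⟨M, hM0, hM⟩ := hH.exists_bound_zero 0
  refine ⟨M + b + 1 / (4 * a), by positivity, fun x v => ?_⟩
  have hl : -M ≤ lagrangian H x v := by
    have h1 := le_ciSup (bddAbove_conjugate ha hco x (-v)) 0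
    have h2 := abs_le.1 (hM x 0 (by simp))
    simp only [inner_zero_left] at h1
    unfold lagrangian conjugate
    linarith
  have hu : lagrangian H x v ≤ ‖v‖ ^ 2 / (4 * a) + b :=
    ciSup_le fun p => by simpa using conjugate_term_le ha hco x (-v) p
  have h4 : 0 ≤ 1 / (4 * a) := by positivity
  have h5 : ‖v‖ ^ 2 / (4 * a) = 1 / (4 * a) * ‖v‖ ^ 2 := by ring
  have h6 : 0 ≤ (M + b) * ‖v‖ ^ 2 := by positivity
  have h7 : 0 ≤ 1 / (4 * a) * ‖v‖ ^ 2 := by positivity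
  refine ⟨by linarith, abs_le.2 ⟨?_, ?_⟩⟩ <;> nlinarith

theorem IsAdmissibleHamiltonian.continuous_lagrangian_space (hH : IsAdmissibleHamiltonian H)
    (v : E d) : Continuous fun x => lagrangian H x v := by
  obtain ⟨a, b, ha, hb, hco⟩ := hH.coercive
  obtain ⟨M, hM0, hM⟩ := hH.exists_bound_zero 0
  -- Beyond this radius, which does not depend on `x`, coercivity puts every term below the one at
  -- `p = 0`; the supremum becomes one over a fixed compact ball.
  set R : ℝ := (‖v‖ + b + M) / a + 1
  have hR : 0 ≤ R := by positivity
  have hcont : Continuous ↿(fun (x : Torus d) (p : E d) => inner ℝ p (-v) - H x p) := by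
    have : Continuous fun z : Torus d × E d => H z.1 z.2 := hH.continuous_uncurry
    exact (continuous_snd.inner continuous_const).sub this
  have hs := (isCompact_closedBall (0 : E d) R).continuous_sSup hcont
  convert hs using 2 with x
  have hbdd := bddAbove_conjugate ha hco x (-v)
  have hbdd' : BddAbove ((fun p : E d => inner ℝ p (-v) - H x p) '' Metric.closedBall 0 R) :=
    hbdd.mono (Set.image_subset_range _ _)
  refine le_antisymm (ciSup_le fun p => ?_) ?_
  · by_cases hp : ‖p‖ ≤ R
    · exact le_csSup hbdd' ⟨p, by simpa using hp, rfl⟩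
    · push Not at hp
      have h0 : inner ℝ (0 : E d) (-v) - H x 0
          ≤ sSup ((fun p : E d => inner ℝ p (-v) - H x p) '' Metric.closedBall 0 R) :=
        le_csSup hbdd' ⟨0, by simpa using hR, rfl⟩
      refine le_trans ?_ h0
      have h1 : inner ℝ p (-v) ≤ ‖p‖ * ‖v‖ := by simpa using real_inner_le_norm p (-v)
      have h2 := abs_le.1 (hM x 0 (by simp))
      have h3 := hco x p
      simp only [inner_zero_left]
      have h4 : ‖v‖ + b + M + a ≤ a * ‖p‖ := by
        have : a * R = ‖v‖ + b + M + a := by simp only [R]; field_simp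
        nlinarith
      have h5 : 1 ≤ ‖p‖ := by
        have : 1 ≤ R := by simp only [R, le_add_iff_nonneg_left]; positivity
        linarith
      have h6 : (‖v‖ + b + M + a) * ‖p‖ ≤ a * ‖p‖ * ‖p‖ := by gcongr
      have h7 : b + M ≤ (b + M) * ‖p‖ := le_mul_of_one_le_right (by positivity) h5
      have h8 : 0 ≤ a * ‖p‖ := by positivity
      nlinarith
  · refine csSup_le ((Metric.nonempty_closedBall.2 hR).image _) ?_
    rintro _ ⟨p, -, rfl⟩
    exact le_ciSup hbdd p

end TorusLagrangian

/-! ### Potentials on probability measures along segments. -/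

section Potentials

/-! ### Convex combinations of probability measures -/

section Mix

variable {X : Type*} [MeasurableSpace X]

theorem mix_apply (s : unitInterval) (μ ν : ProbabilityMeasure X) :
    (mix s μ ν : Measure X)
      = ENNReal.ofReal (1 - s) • (μ : Measure X) + ENNReal.ofReal s • (ν : Measure X) := rfl

theorem integrable_mix {h : X → ℝ} (s : unitInterval) {μ ν : ProbabilityMeasure X}
    (hμ : Integrable h (μ : Measure X)) (hν : Integrable h (ν : Measure X)) :
    Integrable h (mix s μ ν : Measure X) :=
  (hμ.smul_measure ENNReal.ofReal_ne_top).add_measure (hν.smul_measure ENNReal.ofReal_ne_top)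

theorem integral_mix {h : X → ℝ} (s : unitInterval) {μ ν : ProbabilityMeasure X}
    (hμ : Integrable h (μ : Measure X)) (hν : Integrable h (ν : Measure X)) :
    ∫ x, h x ∂(mix s μ ν : Measure X)
      = (1 - s) * ∫ x, h x ∂(μ : Measure X) + s * ∫ x, h x ∂(ν : Measure X) := by
  rw [mix_apply, integral_add_measure (hμ.smul_measure ENNReal.ofReal_ne_top)
    (hν.smul_measure ENNReal.ofReal_ne_top), integral_smul_measure, integral_smul_measure,
    ENNReal.toReal_ofReal (by linarith [s.2.2]), ENNReal.toReal_ofReal s.2.1]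
  simp

theorem mix_zero (μ ν : ProbabilityMeasure X) : mix 0 μ ν = μ := by
  apply Subtype.ext
  change (mix 0 μ ν : Measure X) = μ
  rw [mix_apply]
  simp

/-- Restarting a segment from an interior point towards the same endpoint only reparametrizes it, so
derivatives at the start of segments give right derivatives everywhere. -/
theorem mix_mix {r s t : unitInterval} (h : (t : ℝ) = r + s * (1 - r))
    (μ ν : ProbabilityMeasure X) : mix s (mix r μ ν) ν = mix t μ ν := by
  apply Subtype.ext
  change (mix s (mix r μ ν) ν : Measure X) = (mix t μ ν : Measure X)
  have hs0 := s.2.1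
  have hs1 : 0 ≤ 1 - (s : ℝ) := by linarith [s.2.2]
  have hr0 := r.2.1
  simp only [mix_apply]
  rw [smul_add, smul_smul, smul_smul, add_assoc, ← add_smul, ← ENNReal.ofReal_mul hs1,
    ← ENNReal.ofReal_mul hs1, ← ENNReal.ofReal_add (mul_nonneg hs1 hr0) hs0, h]
  congr 3 <;> ring

theorem continuous_mix [TopologicalSpace X] [OpensMeasurableSpace X]
    (μ ν : ProbabilityMeasure X) : Continuous fun s : unitInterval => mix s μ ν := by
  refine continuous_iff_continuousAt.2 fun s => ?_
  refine ProbabilityMeasure.tendsto_iff_forall_integral_tendsto.2 fun h => ?_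
  simp_rw [integral_mix _ (h.integrable (μ : Measure X)) (h.integrable (ν : Measure X))]
  exact Continuous.tendsto (by fun_prop) s

end Mix

/-! ### The Kantorovich distance -/

variable {d : ℕ}

theorem integrable_of_continuous_torus {h : Torus d → ℝ} (hh : Continuous h) (μ : PTorus d) :
    Integrable h (μ : Measure (Torus d)) :=
  hh.integrable_of_hasCompactSupport (HasCompactSupport.of_compactSpace h)

theorem integral_sub_integral_le_diam {h : Torus d → ℝ} (hh : LipschitzWith 1 h) (μ ν : PTorus d) :
    ∫ x, h x ∂(μ : Measure (Torus d)) - ∫ x, h x ∂(ν : Measure (Torus d))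
      ≤ 2 * Metric.diam (Set.univ : Set (Torus d)) := by
  have hb : ∀ x, |h x - h 0| ≤ Metric.diam (Set.univ : Set (Torus d)) := fun x => by
    have h1 := hh.dist_le_mul x 0
    rw [Real.dist_eq, NNReal.coe_one, one_mul] at h1
    exact h1.trans (Metric.dist_le_diam_of_mem isCompact_univ.isBounded trivial trivial)
  have hi := integrable_of_continuous_torus hh.continuous
  have h1 : ∫ x, h x ∂(μ : Measure (Torus d))
      ≤ ∫ _, (h 0 + Metric.diam (Set.univ : Set (Torus d))) ∂(μ : Measure (Torus d)) :=
    integral_mono (hi μ) (integrable_const _) fun x => by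
      simpa using by linarith [(abs_le.1 (hb x)).2]
  have h2 : ∫ _, (h 0 - Metric.diam (Set.univ : Set (Torus d))) ∂(ν : Measure (Torus d))
      ≤ ∫ x, h x ∂(ν : Measure (Torus d)) :=
    integral_mono (integrable_const _) (hi ν) fun x => by
      simpa using by linarith [(abs_le.1 (hb x)).1]
  simp only [integral_const, probReal_univ, one_smul] at h1 h2
  linarith

theorem dOne_nonneg (μ ν : PTorus d) : 0 ≤ dOne μ ν :=
  Real.sSup_nonneg' ⟨0, ⟨fun _ => 0, LipschitzWith.const' 0, by simp⟩, le_rfl⟩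

theorem dOne_le_of_forall {μ ν : PTorus d} {c : ℝ} (hc : ∀ h : Torus d → ℝ, LipschitzWith 1 h →
    ∫ x, h x ∂(μ : Measure (Torus d)) - ∫ x, h x ∂(ν : Measure (Torus d)) ≤ c) :
    dOne μ ν ≤ c := by
  refine csSup_le ⟨0, fun _ => 0, LipschitzWith.const' 0, by simp⟩ ?_
  rintro _ ⟨h, hh, rfl⟩
  exact hc h hh

theorem dOne_le_diam (μ ν : PTorus d) :
    dOne μ ν ≤ 2 * Metric.diam (Set.univ : Set (Torus d)) :=
  dOne_le_of_forall fun _ hh => integral_sub_integral_le_diam hh μ ν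

theorem dOne_mix_le (s : unitInterval) (μ ν : PTorus d) :
    dOne (mix s μ ν) μ ≤ s * (2 * Metric.diam (Set.univ : Set (Torus d))) := by
  refine dOne_le_of_forall fun h hh => ?_
  have hi := integrable_of_continuous_torus hh.continuous
  rw [integral_mix s (hi μ) (hi ν)]
  have := mul_le_mul_of_nonneg_left (integral_sub_integral_le_diam hh ν μ) s.2.1
  linarith

/-! ### Second-order expansion of a potential -/

variable {k : ℕ} {F : PTorus d → ℝ} {f : Torus d → PTorus d → ℝ}

theorem IsLipschitzIntoCk.exists_abs_sub_le (hf : IsLipschitzIntoCk k f) :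
    ∃ K : ℝ, 0 ≤ K ∧ ∀ x m m', |f x m - f x m'| ≤ K * dOne m m' := by
  obtain ⟨K, hK⟩ := hf.lipschitz
  refine ⟨|K|, abs_nonneg K, fun x m m' => ?_⟩
  obtain ⟨y, rfl⟩ := isOpenQuotientMap_proj.surjective x
  have h := hK m m' 0 (Nat.zero_le k) y
  rw [norm_iteratedFDeriv_zero, Real.norm_eq_abs] at h
  exact h.trans (mul_le_mul_of_nonneg_right (le_abs_self K) (dOne_nonneg m m'))

theorem IsMeasureDeriv.continuous_left (hF : IsMeasureDeriv F f) (m : PTorus d) :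
    Continuous fun x => f x m :=
  hF.continuous_deriv.comp (continuous_id.prodMk continuous_const)

theorem IsMeasureDeriv.integrable (hF : IsMeasureDeriv F f) (m μ : PTorus d) :
    Integrable (fun x => f x m) (μ : Measure (Torus d)) :=
  integrable_of_continuous_torus (hF.continuous_left m) μ

/-- Compactness of the torus bounds `f` at one reference measure; the Lipschitz estimate and the
finite `d₁`-diameter carry the bound to all others. -/
theorem IsMeasureDeriv.exists_bound (hF : IsMeasureDeriv F f) (hf : IsLipschitzIntoCk k f) :
    ∃ M : ℝ, 0 ≤ M ∧ ∀ x m, |f x m| ≤ M := by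
  rcases isEmpty_or_nonempty (PTorus d) with h | ⟨⟨m₁⟩⟩
  · exact ⟨0, le_rfl, fun _ m => h.elim m⟩
  obtain ⟨K, hK0, hK⟩ := hf.exists_abs_sub_le
  obtain ⟨M, hM⟩ := isCompact_univ.exists_bound_of_continuousOn
    (hF.continuous_left m₁).continuousOn
  refine ⟨M + K * (2 * Metric.diam (Set.univ : Set (Torus d))), ?_, fun x m => ?_⟩
  · have := Metric.diam_nonneg (s := (Set.univ : Set (Torus d)))
    have := (norm_nonneg _).trans (hM 0 trivial)
    positivity
  · have h1 := (hK x m m₁).trans (mul_le_mul_of_nonneg_left (dOne_le_diam m m₁) hK0)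
    have h2 := hM x trivial
    rw [Real.norm_eq_abs] at h2
    calc |f x m| = |f x m₁ + (f x m - f x m₁)| := by ring_nf
      _ ≤ |f x m₁| + |f x m - f x m₁| := abs_add_le _ _
      _ ≤ _ := add_le_add h2 h1

/-- `r ↦ F ((1 - r) m + r m')` on the real line, constant outside of `[0, 1]`. -/
def alongSegment (F : PTorus d → ℝ) (m m' : PTorus d) (r : ℝ) : ℝ :=
  F (mix (Set.projIcc 0 1 zero_le_one r) m m')

/-- The pairing `∫ f(x, m₁) d(m' - m)(x)`. -/
def pairing (f : Torus d → PTorus d → ℝ) (m₁ m m' : PTorus d) : ℝ :=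
  ∫ x, f x m₁ ∂(m' : Measure (Torus d)) - ∫ x, f x m₁ ∂(m : Measure (Torus d))

/-- The hypothesis is applied to the segment from the mixture at `r` to `m'`, with parameter `(y -
r) / (1 - r)`. The pairing there carries a factor `1 - r`, which cancels the change of parameter. -/
theorem IsMeasureDeriv.hasDerivWithinAt_alongSegment (hF : IsMeasureDeriv F f) (m m' : PTorus d)
    {r : ℝ} (hr : r ∈ Set.Ico (0 : ℝ) 1) :
    HasDerivWithinAt (alongSegment F m m')
      (pairing f (mix (Set.projIcc 0 1 zero_le_one r) m m') m m') (Set.Ici r) r := by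
  obtain ⟨hr0, hr1⟩ := hr
  have hr1' : 0 < 1 - r := by linarith
  set ρ : unitInterval := Set.projIcc 0 1 zero_le_one r with hρ
  have hρr : (ρ : ℝ) = r := by rw [hρ, Set.projIcc_of_mem zero_le_one ⟨hr0, hr1.le⟩]
  have hT := hF.tendsto (mix ρ m m') m'
  have hval : ∫ x, f x (mix ρ m m') ∂(m' : Measure (Torus d))
      - ∫ x, f x (mix ρ m m') ∂(mix ρ m m' : Measure (Torus d))
      = (1 - r) * pairing f (mix ρ m m') m m' := by
    rw [integral_mix ρ (hF.integrable _ m) (hF.integrable _ m'), hρr, pairing]; ring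
  rw [hval] at hT
  let σ : ℝ → unitInterval := fun y => Set.projIcc 0 1 zero_le_one ((y - r) / (1 - r))
  have hmem : ∀ y ∈ Set.Ioo r 1, (y - r) / (1 - r) ∈ Set.Icc (0 : ℝ) 1 := fun y hy =>
    ⟨div_nonneg (by linarith [hy.1]) hr1'.le, (div_le_one hr1').2 (by linarith [hy.2])⟩
  have hσv : ∀ y ∈ Set.Ioo r 1, (σ y : ℝ) = (y - r) / (1 - r) := fun y hy => by
    simp only [σ, Set.projIcc_of_mem zero_le_one (hmem y hy)]
  have hIoo : Set.Ioo r 1 ∈ 𝓝[>] r := Ioo_mem_nhdsGT hr1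
  have hσ : Tendsto σ (𝓝[>] r) (𝓝[>] 0) := by
    refine tendsto_nhdsWithin_iff.2 ⟨?_, ?_⟩
    · have hc : Continuous σ := continuous_projIcc.comp (by fun_prop)
      have h0 : σ r = 0 := by simp [σ]
      have := hc.tendsto r
      rw [h0] at this
      exact this.mono_left nhdsWithin_le_nhds
    · filter_upwards [hIoo] with y hy
      change (0 : ℝ) < σ y
      rw [hσv y hy]
      exact div_pos (by linarith [hy.1]) hr1'
  rw [← hasDerivWithinAt_Ioi_iff_Ici, hasDerivWithinAt_iff_tendsto_slope' Set.self_notMem_Ioi]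
  have h := (hT.comp hσ).const_mul (1 - r)⁻¹
  rw [← mul_assoc, inv_mul_cancel₀ hr1'.ne', one_mul] at h
  refine h.congr' ?_
  filter_upwards [hIoo] with y hy
  have hy0 : 0 < y - r := by linarith [hy.1]
  have hy1 : y ∈ Set.Icc (0 : ℝ) 1 := ⟨by linarith [hy.1], hy.2.le⟩
  have hm : mix (σ y) (mix ρ m m') m' = mix (Set.projIcc 0 1 zero_le_one y) m m' := by
    refine mix_mix ?_ m m'
    rw [Set.projIcc_of_mem zero_le_one hy1, hσv y hy, hρr]
    field_simp
    ring
  simp only [Function.comp, hm, hσv y hy, slope_def_field, alongSegment, ← hρ]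
  field_simp

/-- The remainder vanishes at `0` and its right derivative at `r` is at most `2Kδr`, the factor `2`
coming from the two integrals in the pairing. As only right derivatives are available, it is
compared with the barrier `Kδr²` by the one-sided mean value inequality. -/
theorem IsMeasureDeriv.exists_expansion (hF : IsMeasureDeriv F f) (hf : IsLipschitzIntoCk k f) :
    ∃ C : ℝ, 0 ≤ C ∧ ∀ (m m' : PTorus d) (s : unitInterval),
      |F (mix s m m') - F m - s * pairing f m m m'| ≤ C * (s : ℝ) ^ 2 := by
  obtain ⟨K, hK0, hK⟩ := hf.exists_abs_sub_le
  set δ : ℝ := 2 * Metric.diam (Set.univ : Set (Torus d)) with hδ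
  have hδ0 : 0 ≤ δ := mul_nonneg zero_le_two Metric.diam_nonneg
  refine ⟨K * δ, by positivity, fun m m' s => ?_⟩
  have hstep : ∀ r ∈ Set.Icc (0 : ℝ) 1,
      |pairing f (mix (Set.projIcc 0 1 zero_le_one r) m m') m m' - pairing f m m m'|
        ≤ 2 * (K * δ) * r := by
    intro r hr
    set ρ : unitInterval := Set.projIcc 0 1 zero_le_one r with hρ
    have hρr : (ρ : ℝ) = r := by rw [hρ, Set.projIcc_of_mem zero_le_one hr]
    have hb : ∀ x, ‖f x (mix ρ m m') - f x m‖ ≤ K * (r * δ) := fun x => by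
      have := dOne_mix_le ρ m m'
      rw [hρr] at this
      exact (hK x _ _).trans (mul_le_mul_of_nonneg_left this hK0)
    have hI : ∀ μ : PTorus d, |∫ x, f x (mix ρ m m') ∂(μ : Measure (Torus d))
        - ∫ x, f x m ∂(μ : Measure (Torus d))| ≤ K * (r * δ) := fun μ => by
      rw [← integral_sub (hF.integrable _ μ) (hF.integrable _ μ)]
      have := norm_integral_le_of_norm_le_const (μ := (μ : Measure (Torus d)))
        (Eventually.of_forall hb)
      simpa using this
    have h1 := abs_le.1 (hI m)
    have h2 := abs_le.1 (hI m')
    simp only [pairing]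
    exact abs_le.2 ⟨by linarith, by linarith⟩
  have hcont : Continuous (alongSegment F m m') :=
    hF.continuous_potential.comp ((continuous_mix m m').comp continuous_projIcc)
  have h0 : alongSegment F m m' 0 = F m := by
    simp only [alongSegment, Set.projIcc_left]
    exact congrArg F (mix_zero m m')
  have hs : alongSegment F m m' s = F (mix s m m') := by
    simp only [alongSegment, Set.projIcc_val]
  have key := image_norm_le_of_norm_deriv_right_le_deriv_boundary (a := 0) (b := 1)
    (f := fun r => alongSegment F m m' r - F m - r * pairing f m m m')
    (f' := fun r => pairing f (mix (Set.projIcc 0 1 zero_le_one r) m m') m m' - pairing f m m m')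
    (B := fun r => K * δ * r ^ 2) (B' := fun r => 2 * (K * δ) * r)
    (by fun_prop) (fun r hr => ?_) (by simp [h0])
    (fun r => ((hasDerivAt_pow 2 r).const_mul (K * δ)).congr_deriv (by norm_num; ring))
    (fun r hr => hstep r ⟨hr.1, hr.2.le⟩) (x := s) s.2
  · simpa only [hs, Real.norm_eq_abs] using key
  · have h1 := (hF.hasDerivWithinAt_alongSegment m m' hr).sub_const (F m)
    exact (h1.sub ((hasDerivWithinAt_id r _).mul_const (pairing f m m m'))).congr_deriv (by simp)

end Potentials

/-! ### Costs of curves, and measurability of the optimal kinetic cost. -/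

section CurveCosts

variable {d : ℕ} {T : ℝ}

/-! ### Marginals -/

instance isFiniteMeasure_timeMeasure (T : ℝ) : IsFiniteMeasure (timeMeasure T) := ⟨by
  rw [timeMeasure, (MeasurableEmbedding.subtype_coe measurableSet_Icc).comap_apply,
    Set.image_univ, Subtype.range_coe]
  exact measure_Icc_lt_top⟩

theorem marginal_apply (η : ProbabilityMeasure (Curve d T)) (t : Set.Icc (0 : ℝ) T) :
    (marginal η t : Measure (Torus d))
      = Measure.map (fun γ : Curve d T => γ t) (η : Measure (Curve d T)) := rfl

theorem integral_marginal (η : ProbabilityMeasure (Curve d T)) (t : Set.Icc (0 : ℝ) T)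
    {h : Torus d → ℝ} (hh : Continuous h) :
    ∫ x, h x ∂(marginal η t : Measure (Torus d)) = ∫ γ, h (γ t) ∂(η : Measure (Curve d T)) := by
  rw [marginal_apply, integral_map (continuous_eval_const t).measurable.aemeasurable
    hh.aestronglyMeasurable]

theorem continuous_marginal (η : ProbabilityMeasure (Curve d T)) : Continuous (marginal η) := by
  refine continuous_iff_continuousAt.2 fun t => ?_
  refine ProbabilityMeasure.tendsto_iff_forall_integral_tendsto.2 fun h => ?_
  simp_rw [integral_marginal η _ h.continuous]
  have : Continuous fun s => ∫ γ : Curve d T, h (γ s) ∂(η : Measure (Curve d T)) :=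
    continuous_of_dominated (bound := fun _ => ‖h‖)
      (fun s => (h.continuous.comp (continuous_eval_const s)).aestronglyMeasurable)
      (fun s => Eventually.of_forall fun γ => h.norm_coe_le_norm _) (integrable_const _)
      (Eventually.of_forall fun γ => h.continuous.comp γ.continuous)
  exact this.tendsto t

theorem marginal_mix (s : unitInterval) (η θ : ProbabilityMeasure (Curve d T))
    (t : Set.Icc (0 : ℝ) T) :
    marginal (mix s η θ) t = mix s (marginal η t) (marginal θ t) := by
  apply Subtype.ext
  change (marginal (mix s η θ) t : Measure (Torus d))
    = (mix s (marginal η t) (marginal θ t) : Measure (Torus d))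
  have hm : Measurable fun γ : Curve d T => γ t := (continuous_eval_const t).measurable
  simp only [marginal_apply, mix_apply, Measure.map_add _ _ hm, Measure.map_smul]

/-! ### The part of the cost that does not depend on the velocity -/

variable {k l : ℕ} {H : Torus d → E d → ℝ} {f g : Torus d → PTorus d → ℝ} {F G : PTorus d → ℝ}

/-- The part `∫₀ᵀ f(γ(s), e_s # η) ds + g(γ(T), e_T # η)` of the cost `J(γ(0), γ, η)`. -/
def couplingCost (hT : 0 < T) (f g : Torus d → PTorus d → ℝ)
    (η : ProbabilityMeasure (Curve d T)) (γ : Curve d T) : ℝ :=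
  ∫ s, f (γ s) (marginal η s) ∂(timeMeasure T) + g (γ (endTime hT)) (marginal η (endTime hT))

theorem continuous_coupling_integrand (hF : IsMeasureDeriv F f)
    (η : ProbabilityMeasure (Curve d T)) :
    Continuous fun z : Curve d T × Set.Icc (0 : ℝ) T => f (z.1 z.2) (marginal η z.2) :=
  hF.continuous_deriv.comp
    (continuous_eval.prodMk ((continuous_marginal η).comp continuous_snd))

theorem integrable_coupling_integrand (hF : IsMeasureDeriv F f) (hf : IsLipschitzIntoCk k f)
    (η : ProbabilityMeasure (Curve d T)) (γ : Curve d T) :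
    Integrable (fun s => f (γ s) (marginal η s)) (timeMeasure T) := by
  obtain ⟨M, -, hM⟩ := hF.exists_bound hf
  have hc := (continuous_coupling_integrand hF η).comp (continuous_const (y := γ).prodMk
    continuous_id)
  exact Integrable.of_bound hc.aestronglyMeasurable M (Eventually.of_forall fun s => hM _ _)

theorem continuous_couplingCost (hT : 0 < T) (hF : IsMeasureDeriv F f)
    (hf : IsLipschitzIntoCk k f) (hG : IsMeasureDeriv G g) (η : ProbabilityMeasure (Curve d T)) :
    Continuous (couplingCost hT f g η) := by
  obtain ⟨M, -, hM⟩ := hF.exists_bound hf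
  refine Continuous.add ?_ ((hG.continuous_left _).comp (continuous_eval_const _))
  exact continuous_of_dominated (bound := fun _ => M)
    (fun γ => (integrable_coupling_integrand hF hf η γ).aestronglyMeasurable)
    (fun γ => Eventually.of_forall fun s => hM _ _) (integrable_const _)
    (Eventually.of_forall fun s => (continuous_coupling_integrand hF η).comp
      (continuous_id.prodMk continuous_const))

theorem exists_bound_couplingCost (hT : 0 < T) (hF : IsMeasureDeriv F f)
    (hf : IsLipschitzIntoCk k f) (hG : IsMeasureDeriv G g) (hg : IsLipschitzIntoCk l g)
    (η : ProbabilityMeasure (Curve d T)) :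
    ∃ M : ℝ, ∀ γ, |couplingCost hT f g η γ| ≤ M := by
  obtain ⟨M, -, hM⟩ := hF.exists_bound hf
  obtain ⟨N, -, hN⟩ := hG.exists_bound hg
  refine ⟨M * (timeMeasure T).real Set.univ + N, fun γ => ?_⟩
  have h : ‖∫ s, f (γ s) (marginal η s) ∂(timeMeasure T)‖ ≤ M * (timeMeasure T).real Set.univ :=
    norm_integral_le_of_norm_le_const (Eventually.of_forall fun s => hM _ _)
  exact (abs_add_le _ _).trans (add_le_add h (hN _ _))

theorem integrable_couplingCost (hT : 0 < T) (hF : IsMeasureDeriv F f)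
    (hf : IsLipschitzIntoCk k f) (hG : IsMeasureDeriv G g) (hg : IsLipschitzIntoCk l g)
    (η μ : ProbabilityMeasure (Curve d T)) :
    Integrable (couplingCost hT f g η) (μ : Measure (Curve d T)) := by
  obtain ⟨M, hM⟩ := exists_bound_couplingCost hT hF hf hG hg η
  exact Integrable.of_bound (continuous_couplingCost hT hF hf hG η).aestronglyMeasurable M
    (Eventually.of_forall hM)

/-- Fubini, valid since `f` is bounded. It identifies the first-order terms of `F` and `G` with
integrals of the cost over curves. -/
theorem integral_couplingCost (hT : 0 < T) (hF : IsMeasureDeriv F f)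
    (hf : IsLipschitzIntoCk k f) (hG : IsMeasureDeriv G g) (hg : IsLipschitzIntoCk l g)
    (η μ : ProbabilityMeasure (Curve d T)) :
    ∫ γ, couplingCost hT f g η γ ∂(μ : Measure (Curve d T))
      = ∫ t, (∫ x, f x (marginal η t) ∂(marginal μ t : Measure (Torus d))) ∂(timeMeasure T)
        + ∫ x, g x (marginal η (endTime hT)) ∂(marginal μ (endTime hT) : Measure (Torus d)) := by
  obtain ⟨M, -, hM⟩ := hF.exists_bound hf
  obtain ⟨N, -, hN⟩ := hG.exists_bound hg
  have hc := continuous_coupling_integrand hF η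
  have hi : Integrable (Function.uncurry fun (γ : Curve d T) s => f (γ s) (marginal η s))
      ((μ : Measure (Curve d T)).prod (timeMeasure T)) :=
    Integrable.of_bound hc.aestronglyMeasurable M (Eventually.of_forall fun z => hM _ _)
  have hj : Integrable (fun γ : Curve d T => g (γ (endTime hT)) (marginal η (endTime hT)))
      (μ : Measure (Curve d T)) :=
    Integrable.of_bound ((hG.continuous_left _).comp (continuous_eval_const _)).aestronglyMeasurable
      N (Eventually.of_forall fun z => hN _ _)
  have hi' : Integrable (fun γ : Curve d T => ∫ s, f (γ s) (marginal η s) ∂(timeMeasure T))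
      (μ : Measure (Curve d T)) := hi.integral_prod_left
  simp only [couplingCost]
  rw [integral_add hi' hj, integral_integral_swap hi,
    integral_marginal μ _ (hG.continuous_left _)]
  simp_rw [integral_marginal μ _ (hF.continuous_left _)]

/-! ### The kinetic part of the cost -/

/-- The kinetic cost `∫₀ᵀ L(γ, γ')`, as a real number (irrelevant if `γ ∉ H¹`). -/
def realKinetic (hT : 0 < T) (H : Torus d → E d → ℝ) (γ : Curve d T) : ℝ :=
  ∫ s, lagrangian H (γ s) (velocity hT γ s) ∂(timeMeasure T)

theorem IsHOne.memLp_velocity {hT : 0 < T} {γ : Curve d T} (h : IsHOne hT γ) :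
    MemLp (velocity hT γ) 2 (timeMeasure T) := by
  rw [velocity, dif_pos h]
  exact h.choose_spec.1

theorem IsHOne.integrable_one_add_sq {hT : 0 < T} {γ : Curve d T} (h : IsHOne hT γ) (C : ℝ) :
    Integrable (fun s => C * (1 + ‖velocity hT γ s‖ ^ 2)) (timeMeasure T) :=
  ((integrable_const _).add h.memLp_velocity.integrable_norm_pow').const_mul C

theorem IsHOne.aestronglyMeasurable_lagrangian {hT : 0 < T} {γ : Curve d T} (h : IsHOne hT γ)
    (hH : IsAdmissibleHamiltonian H) {c : Set.Icc (0 : ℝ) T → Torus d} (hc : Continuous c) :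
    AEStronglyMeasurable (fun s => lagrangian H (c s) (velocity hT γ s)) (timeMeasure T) :=
  (hH.measurable_lagrangian.comp_aemeasurable (hc.measurable.aemeasurable.prodMk
    h.memLp_velocity.aestronglyMeasurable.aemeasurable)).aestronglyMeasurable

theorem IsHOne.integrable_lagrangian {hT : 0 < T} {γ : Curve d T} (h : IsHOne hT γ)
    (hH : IsAdmissibleHamiltonian H) :
    Integrable (fun s => lagrangian H (γ s) (velocity hT γ s)) (timeMeasure T) := by
  obtain ⟨C, -, hC⟩ := hH.lagrangian_bound
  exact (h.integrable_one_add_sq C).mono' (h.aestronglyMeasurable_lagrangian hH γ.continuous)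
    (Eventually.of_forall fun s => (hC _ _).2)

theorem IsHOne.kineticCost_eq {hT : 0 < T} {γ : Curve d T} (h : IsHOne hT γ) :
    kineticCost hT H γ = (realKinetic hT H γ : EReal) := if_pos h

theorem IsHOne.J_eq {hT : 0 < T} {γ : Curve d T} (h : IsHOne hT γ)
    (hH : IsAdmissibleHamiltonian H) (hF : IsMeasureDeriv F f) (hf : IsLipschitzIntoCk k f)
    (η : ProbabilityMeasure (Curve d T)) :
    J hT H f g η γ = ((realKinetic hT H γ + couplingCost hT f g η γ : ℝ) : EReal) := by
  rw [J, if_pos h, integral_add (h.integrable_lagrangian hH)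
    (integrable_coupling_integrand hF hf η γ), add_assoc]
  rfl

theorem IsAdmissibleHamiltonian.exists_le_realKinetic (hH : IsAdmissibleHamiltonian H)
    (hT : 0 < T) : ∃ C : ℝ, ∀ γ : Curve d T, IsHOne hT γ → C ≤ realKinetic hT H γ := by
  obtain ⟨C, -, hC⟩ := hH.lagrangian_bound
  refine ⟨∫ _, -C ∂(timeMeasure T), fun γ h => ?_⟩
  exact integral_mono (integrable_const _) (h.integrable_lagrangian hH) fun s => (hC _ _).1

/-! ### Translated curves and the value function -/

/-- The curve `γ + z`. -/
def translate (γ : Curve d T) (z : Torus d) : Curve d T := γ + ContinuousMap.const _ z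

theorem translate_apply (γ : Curve d T) (z : Torus d) (t : Set.Icc (0 : ℝ) T) :
    translate γ z t = γ t + z := rfl

theorem continuous_translate (γ : Curve d T) : Continuous (translate γ) :=
  continuous_const.add ContinuousMap.continuous_const'

/-- Equality of the predicates themselves ensures that the choice in `velocity` returns the same
function for a curve and its translates, not just one equal almost everywhere. -/
theorem isVelocity_translate (hT : 0 < T) (γ : Curve d T) (z : Torus d) :
    IsVelocity hT (translate γ z) = IsVelocity hT γ := by
  funext v
  refine propext (and_congr_right fun _ => forall_congr' fun t => ?_)
  rw [translate_apply, translate_apply, add_right_comm, add_left_inj]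

theorem velocity_translate (hT : 0 < T) (γ : Curve d T) (z : Torus d) :
    velocity hT (translate γ z) = velocity hT γ := by
  unfold velocity IsHOne
  rw [isVelocity_translate]

theorem IsHOne.translate {hT : 0 < T} {γ : Curve d T} (h : IsHOne hT γ) (z : Torus d) :
    IsHOne hT (translate γ z) := by
  unfold IsHOne
  rw [isVelocity_translate]
  exact h

theorem IsHOne.continuous_realKinetic_translate {hT : 0 < T} {γ : Curve d T} (h : IsHOne hT γ)
    (hH : IsAdmissibleHamiltonian H) :
    Continuous fun z => realKinetic hT H (MFG.translate γ z) := by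
  obtain ⟨C, -, hC⟩ := hH.lagrangian_bound
  simp only [realKinetic, velocity_translate, translate_apply]
  exact continuous_of_dominated
    (fun z => h.aestronglyMeasurable_lagrangian hH (γ.continuous.add continuous_const))
    (fun z => Eventually.of_forall fun s => (hC _ _).2) (h.integrable_one_add_sq C)
    (Eventually.of_forall fun s => (hH.continuous_lagrangian_space _).comp
      (continuous_const.add continuous_id))

/-- The optimal curve from `x`, translated to start at `y`, is a competitor at `y` whose cost is
continuous in `y` and equals the optimal cost at `y = x`. -/
theorem upperSemicontinuous_value {hT : 0 < T} (hH : IsAdmissibleHamiltonian H)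
    (hF : IsMeasureDeriv F f) (hf : IsLipschitzIntoCk k f) (hG : IsMeasureDeriv G g)
    {η : ProbabilityMeasure (Curve d T)} {Γ : Torus d → Curve d T}
    (hΓ : ∀ x, IsOptimal hT H f g η x (Γ x)) :
    UpperSemicontinuous fun x => realKinetic hT H (Γ x) + couplingCost hT f g η (Γ x) := by
  intro x c hc
  let w : Torus d → ℝ := fun y => realKinetic hT H (translate (Γ x) (y - x))
    + couplingCost hT f g η (translate (Γ x) (y - x))
  have hw : Continuous w :=
    (((hΓ x).isHOne.continuous_realKinetic_translate hH).add
      ((continuous_couplingCost hT hF hf hG η).comp (continuous_translate (Γ x)))).comp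
      (continuous_id.sub continuous_const)
  have hwx : w x < c := by
    have : translate (Γ x) (x - x) = Γ x := by
      ext1 t; rw [translate_apply, sub_self, add_zero]
    simpa only [w, this] using hc
  filter_upwards [hw.tendsto x (Iio_mem_nhds hwx)] with y hy
  refine lt_of_le_of_lt ?_ hy
  have hle := (hΓ y).le (translate (Γ x) (y - x)) ((hΓ x).isHOne.translate _)
    (by rw [translate_apply, (hΓ x).start, add_sub_cancel])
  rw [(hΓ y).isHOne.J_eq hH hF hf η, ((hΓ x).isHOne.translate _).J_eq hH hF hf η] at hle
  exact EReal.coe_le_coe_iff.1 hle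

theorem integrable_realKinetic_optimal {hT : 0 < T} (hH : IsAdmissibleHamiltonian H)
    (hF : IsMeasureDeriv F f) (hf : IsLipschitzIntoCk k f) (hG : IsMeasureDeriv G g)
    (hg : IsLipschitzIntoCk l g)
    {η : ProbabilityMeasure (Curve d T)} {Γ : Torus d → Curve d T} (hm : Measurable Γ)
    (hΓ : ∀ x, IsOptimal hT H f g η x (Γ x)) (m : PTorus d) :
    Integrable (fun x => realKinetic hT H (Γ x)) (m : Measure (Torus d)) := by
  have husc := upperSemicontinuous_value hH hF hf hG hΓ
  obtain ⟨A, hA⟩ := hH.exists_le_realKinetic hT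
  obtain ⟨M, hM⟩ := exists_bound_couplingCost hT hF hf hG hg η
  obtain ⟨B, hB⟩ := (husc.upperSemicontinuousOn Set.univ).bddAbove_of_isCompact isCompact_univ
  -- The kinetic cost is recovered as the value function minus the coupling cost, without any
  -- measurable choice of velocities.
  have hmeas : Measurable fun x => realKinetic hT H (Γ x) := by
    have := husc.measurable.sub ((continuous_couplingCost hT hF hf hG η).measurable.comp hm)
    convert this using 1
    funext x
    simp
  refine Integrable.of_bound hmeas.aestronglyMeasurable (max (B + M) (-A))
    (Eventually.of_forall fun x => abs_le.2 ⟨?_, ?_⟩)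
  · have := hA _ (hΓ x).isHOne
    have := le_max_right (B + M) (-A)
    linarith
  · have h1 : realKinetic hT H (Γ x) + couplingCost hT f g η (Γ x) ≤ B :=
      hB ⟨x, trivial, rfl⟩
    have h2 := (abs_le.1 (hM (Γ x))).1
    have := le_max_left (B + M) (-A)
    linarith

end CurveCosts

/-! ### Expansion of the potential and descent along the play. -/

section Play

variable {d : ℕ} {T : ℝ} {k l : ℕ} {H : Torus d → E d → ℝ} {f g : Torus d → PTorus d → ℝ}
  {F G : PTorus d → ℝ}

/-! ### Measures on curves with finite kinetic cost -/

/-- Only almost everywhere agreement matters, so `ψ` may be infinite on a null set (curves outside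
`H¹`) and need not be measurable. -/
theorem integralE_eq_coe_integral {X : Type*} [MeasurableSpace X] {μ : Measure X} {φ : X → ℝ}
    {ψ : X → EReal} (hφ : Integrable φ μ) (h : ∀ᵐ x ∂μ, ψ x = (φ x : EReal)) :
    integralE μ ψ = ((∫ x, φ x ∂μ : ℝ) : EReal) := by
  have h1 : ∫⁻ x, (ψ x).toENNReal ∂μ = ∫⁻ x, ENNReal.ofReal (φ x) ∂μ :=
    lintegral_congr_ae (h.mono fun x hx => by simp only [hx, EReal.toENNReal_of_ne_top
      (EReal.coe_ne_top _), EReal.toReal_coe])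
  have h2 : ∫⁻ x, (-(ψ x)).toENNReal ∂μ = ∫⁻ x, ENNReal.ofReal (-φ x) ∂μ :=
    lintegral_congr_ae (h.mono fun x hx => by
      simp only [hx, ← EReal.coe_neg, EReal.toENNReal_of_ne_top (EReal.coe_ne_top _),
        EReal.toReal_coe])
  have hneg : ∫⁻ x, ENNReal.ofReal (-φ x) ∂μ ≠ ⊤ := hφ.neg.lintegral_lt_top.ne
  rw [integralE, h1, h2, integral_eq_lintegral_pos_part_sub_lintegral_neg_part hφ, EReal.coe_sub,
    EReal.coe_ennreal_toReal hφ.lintegral_lt_top.ne,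
    EReal.coe_ennreal_toReal hneg]

/-- `μ`-almost every curve is in `H¹`, and the kinetic cost is `μ`-integrable. -/
structure HasFiniteCost (hT : 0 < T) (H : Torus d → E d → ℝ) (μ : Measure (Curve d T)) :
    Prop where
  ae_isHOne : ∀ᵐ γ ∂μ, IsHOne hT γ
  integrable : Integrable (realKinetic hT H) μ

/-- The potential of a measure with finite kinetic cost, as a real number. -/
def realPotential (hT : 0 < T) (H : Torus d → E d → ℝ) (F G : PTorus d → ℝ)
    (η : ProbabilityMeasure (Curve d T)) : ℝ :=
  ∫ γ, realKinetic hT H γ ∂(η : Measure (Curve d T))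
    + (∫ t, F (marginal η t) ∂(timeMeasure T) + G (marginal η (endTime hT)))

/-- The integral `∫ J(γ(0), γ, η) dμ(γ)` for a measure `μ` with finite kinetic cost, as a real
number. -/
def realCost (hT : 0 < T) (H : Torus d → E d → ℝ) (f g : Torus d → PTorus d → ℝ)
    (η μ : ProbabilityMeasure (Curve d T)) : ℝ :=
  ∫ γ, realKinetic hT H γ ∂(μ : Measure (Curve d T))
    + ∫ γ, couplingCost hT f g η γ ∂(μ : Measure (Curve d T))

namespace HasFiniteCost

variable {hT : 0 < T}

theorem mix {η θ : ProbabilityMeasure (Curve d T)}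
    (hη : HasFiniteCost hT H (η : Measure (Curve d T)))
    (hθ : HasFiniteCost hT H (θ : Measure (Curve d T))) (s : unitInterval) :
    HasFiniteCost hT H (MFG.mix s η θ : Measure (Curve d T)) := by
  refine ⟨?_, integrable_mix s hη.integrable hθ.integrable⟩
  rw [mix_apply, ae_add_measure_iff]
  exact ⟨Measure.ae_smul_measure hη.ae_isHOne _, Measure.ae_smul_measure hθ.ae_isHOne _⟩

theorem potential_eq {η : ProbabilityMeasure (Curve d T)}
    (hη : HasFiniteCost hT H (η : Measure (Curve d T))) :
    potential hT H F G η = (realPotential hT H F G η : EReal) := by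
  rw [potential, integralE_eq_coe_integral hη.integrable
    (hη.ae_isHOne.mono fun γ h => h.kineticCost_eq), ← EReal.coe_add, realPotential]

theorem integralE_J_eq {μ : ProbabilityMeasure (Curve d T)}
    (hμ : HasFiniteCost hT H (μ : Measure (Curve d T))) (hH : IsAdmissibleHamiltonian H)
    (hF : IsMeasureDeriv F f) (hf : IsLipschitzIntoCk k f) (hG : IsMeasureDeriv G g)
    (hg : IsLipschitzIntoCk l g) (η : ProbabilityMeasure (Curve d T)) :
    integralE (μ : Measure (Curve d T)) (J hT H f g η) = (realCost hT H f g η μ : EReal) := by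
  have hc := integrable_couplingCost hT hF hf hG hg η μ
  rw [integralE_eq_coe_integral (hμ.integrable.add hc)
    (hμ.ae_isHOne.mono fun γ h => h.J_eq hH hF hf η), realCost, ← integral_add hμ.integrable hc]
  rfl

end HasFiniteCost

/-! ### Second-order expansion of the potential along a segment -/

theorem integrable_pairing (hF : IsMeasureDeriv F f) (hf : IsLipschitzIntoCk k f)
    (η μ : ProbabilityMeasure (Curve d T)) :
    Integrable (fun t => ∫ x, f x (marginal η t) ∂(marginal μ t : Measure (Torus d)))
      (timeMeasure T) := by
  obtain ⟨M, -, hM⟩ := hF.exists_bound hf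
  have hi : Integrable (Function.uncurry fun (γ : Curve d T) s => f (γ s) (marginal η s))
      ((μ : Measure (Curve d T)).prod (timeMeasure T)) :=
    Integrable.of_bound (continuous_coupling_integrand hF η).aestronglyMeasurable M
      (Eventually.of_forall fun z => hM _ _)
  simp_rw [integral_marginal μ _ (hF.continuous_left _)]
  exact hi.integral_prod_right

theorem integrable_potential_marginal (hF : IsMeasureDeriv F f)
    (η : ProbabilityMeasure (Curve d T)) :
    Integrable (fun t => F (marginal η t)) (timeMeasure T) :=
  (hF.continuous_potential.comp (continuous_marginal η)).integrable_of_hasCompactSupport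
    (HasCompactSupport.of_compactSpace _)

theorem exists_expansion_coupling (hT : 0 < T) (hF : IsMeasureDeriv F f)
    (hf : IsLipschitzIntoCk k f) (hG : IsMeasureDeriv G g) (hg : IsLipschitzIntoCk l g) :
    ∃ C : ℝ, 0 ≤ C ∧ ∀ (η θ : ProbabilityMeasure (Curve d T)) (s : unitInterval),
      |(∫ t, F (marginal (mix s η θ) t) ∂(timeMeasure T)
          + G (marginal (mix s η θ) (endTime hT)))
        - (∫ t, F (marginal η t) ∂(timeMeasure T) + G (marginal η (endTime hT)))
        - s * (∫ γ, couplingCost hT f g η γ ∂(θ : Measure (Curve d T))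
          - ∫ γ, couplingCost hT f g η γ ∂(η : Measure (Curve d T)))| ≤ C * (s : ℝ) ^ 2 := by
  obtain ⟨A, hA0, hA⟩ := hF.exists_expansion hf
  obtain ⟨B, hB0, hB⟩ := hG.exists_expansion hg
  refine ⟨A * (timeMeasure T).real Set.univ + B, by positivity, fun η θ s => ?_⟩
  have e1 := integral_couplingCost hT hF hf hG hg η θ
  have e2 := integral_couplingCost hT hF hf hG hg η η
  have iθ := integrable_pairing hF hf η θ
  have iη := integrable_pairing hF hf η η
  have i1 := integrable_potential_marginal hF (mix s η θ)
  have i2 := integrable_potential_marginal hF η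
  have hb := hB (marginal η (endTime hT)) (marginal θ (endTime hT)) s
  rw [← marginal_mix] at hb
  have ha : ‖∫ t, (F (marginal (mix s η θ) t) - F (marginal η t)
      - s * pairing f (marginal η t) (marginal η t) (marginal θ t)) ∂(timeMeasure T)‖
      ≤ A * (s : ℝ) ^ 2 * (timeMeasure T).real Set.univ :=
    norm_integral_le_of_norm_le_const (Eventually.of_forall fun t => by
      rw [marginal_mix]; exact hA _ _ s)
  have e3 : ∫ t, (F (marginal (mix s η θ) t) - F (marginal η t)
      - s * pairing f (marginal η t) (marginal η t) (marginal θ t)) ∂(timeMeasure T)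
      = ∫ t, F (marginal (mix s η θ) t) ∂(timeMeasure T) - ∫ t, F (marginal η t) ∂(timeMeasure T)
        - s * (∫ t, (∫ x, f x (marginal η t) ∂(marginal θ t : Measure (Torus d))) ∂(timeMeasure T)
          - ∫ t, (∫ x, f x (marginal η t) ∂(marginal η t : Measure (Torus d)))
            ∂(timeMeasure T)) := by
    have i3 : Integrable (fun t => F (marginal (mix s η θ) t) - F (marginal η t))
      (timeMeasure T) := i1.sub i2
    have i4 : Integrable (fun t => s * pairing f (marginal η t) (marginal η t) (marginal θ t))
      (timeMeasure T) := (iθ.sub iη).const_mul _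
    rw [integral_sub i3 i4]
    simp only [pairing]
    rw [integral_sub i1 i2,
      integral_const_mul, integral_sub iθ iη]
  rw [e3, Real.norm_eq_abs] at ha
  rw [e1, e2]
  simp only [pairing] at hb
  have ha' := abs_le.1 ha
  have hb' := abs_le.1 hb
  exact abs_le.2 ⟨by linarith, by linarith⟩

/-- The kinetic integral is affine along the segment, so its increment cancels exactly and the
constant is that of the coupling part. -/
theorem exists_expansion_realPotential (hT : 0 < T) (hF : IsMeasureDeriv F f)
    (hf : IsLipschitzIntoCk k f) (hG : IsMeasureDeriv G g) (hg : IsLipschitzIntoCk l g)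
    (H : Torus d → E d → ℝ) :
    ∃ C : ℝ, 0 ≤ C ∧ ∀ η θ : ProbabilityMeasure (Curve d T),
      HasFiniteCost hT H (η : Measure (Curve d T)) →
      HasFiniteCost hT H (θ : Measure (Curve d T)) → ∀ s : unitInterval,
      |realPotential hT H F G (mix s η θ) - realPotential hT H F G η
        - s * (realCost hT H f g η θ - realCost hT H f g η η)| ≤ C * (s : ℝ) ^ 2 := by
  obtain ⟨C, hC0, hC⟩ := exists_expansion_coupling (T := T) hT hF hf hG hg
  refine ⟨C, hC0, fun η θ hη hθ s => ?_⟩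
  convert hC η θ s using 2
  rw [realPotential, realPotential, realCost, realCost,
    integral_mix s hη.integrable hθ.integrable]
  ring

theorem tendsto_slope_of_expansion {P : unitInterval → ℝ} {p D C : ℝ}
    (h : ∀ s : unitInterval, |P s - p - s * D| ≤ C * (s : ℝ) ^ 2) :
    Tendsto (fun s : unitInterval => (P s - p) / (s : ℝ)) (𝓝[>] 0) (𝓝 D) := by
  rw [tendsto_iff_norm_sub_tendsto_zero]
  have hlim : Tendsto (fun s : unitInterval => C * (s : ℝ)) (𝓝[>] 0) (𝓝 0) := by
    have : Continuous fun s : unitInterval => C * (s : ℝ) := by fun_prop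
    simpa using (this.tendsto 0).mono_left nhdsWithin_le_nhds
  refine squeeze_zero' (Eventually.of_forall fun _ => norm_nonneg _) ?_ hlim
  filter_upwards [self_mem_nhdsWithin] with s hs
  have hs' : (0 : ℝ) < s := hs
  have : (P s - p) / s - D = (P s - p - s * D) / s := by field_simp
  rw [this, Real.norm_eq_abs, abs_div, abs_of_pos hs', div_le_iff₀ hs']
  exact (h s).trans (le_of_eq (by ring))

theorem hasDerivTowards_potential {hT : 0 < T} {η θ : ProbabilityMeasure (Curve d T)} {D C : ℝ}
    (hη : HasFiniteCost hT H (η : Measure (Curve d T)))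
    (hθ : HasFiniteCost hT H (θ : Measure (Curve d T)))
    (h : ∀ s : unitInterval, |realPotential hT H F G (mix s η θ) - realPotential hT H F G η
      - s * D| ≤ C * (s : ℝ) ^ 2) :
    HasDerivTowards (potential hT H F G) η θ D := by
  refine ⟨?_, ?_, ?_⟩
  · rw [hη.potential_eq]; exact ⟨EReal.coe_ne_bot _, EReal.coe_ne_top _⟩
  · rw [hθ.potential_eq]; exact ⟨EReal.coe_ne_bot _, EReal.coe_ne_top _⟩
  · simp_rw [fun s => (hη.mix hθ s).potential_eq (F := F) (G := G), hη.potential_eq,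
      ← EReal.coe_sub, ← EReal.coe_div]
    exact (continuous_coe_real_ereal.tendsto D).comp (tendsto_slope_of_expansion h)

/-! ### The fictitious play -/

/-- Evaluation at time `0` is a left inverse, and an injective Borel map is an embedding here
(Lusin–Souslin). Change of variables along an embedding requires no measurability of the integrand
on curves. -/
theorem measurableEmbedding_of_start {hT : 0 < T} {Γ : Torus d → Curve d T} (hm : Measurable Γ)
    (hs : ∀ x, Γ x (startTime hT) = x) : MeasurableEmbedding Γ :=
  hm.measurableEmbedding fun x y hxy => by rw [← hs x, ← hs y, hxy]

theorem hasFiniteCost_map_optimal {hT : 0 < T} (hH : IsAdmissibleHamiltonian H)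
    (hF : IsMeasureDeriv F f) (hf : IsLipschitzIntoCk k f) (hG : IsMeasureDeriv G g)
    (hg : IsLipschitzIntoCk l g)
    {η : ProbabilityMeasure (Curve d T)} {Γ : Torus d → Curve d T} (hm : Measurable Γ)
    (hΓ : ∀ x, IsOptimal hT H f g η x (Γ x)) (m : PTorus d) :
    HasFiniteCost hT H (Measure.map Γ (m : Measure (Torus d))) := by
  have hemb := measurableEmbedding_of_start hm fun x => (hΓ x).start
  exact ⟨hemb.ae_map_iff.2 (Eventually.of_forall fun x => (hΓ x).isHOne),
    hemb.integrable_map_iff.2 (integrable_realKinetic_optimal hH hF hf hG hg hm hΓ m)⟩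

/-- A best response to `η` has the least cost against `η`, among the images of `m` by maps that
select curves of `H¹`. -/
theorem realCost_le_of_optimal {hT : 0 < T} (hH : IsAdmissibleHamiltonian H)
    (hF : IsMeasureDeriv F f) (hf : IsLipschitzIntoCk k f) (hG : IsMeasureDeriv G g)
    (hg : IsLipschitzIntoCk l g) {η θ μ : ProbabilityMeasure (Curve d T)} {m : PTorus d}
    {Γ Γ' : Torus d → Curve d T} (hm : Measurable Γ) (hm' : Measurable Γ')
    (hΓ : ∀ x, IsOptimal hT H f g η x (Γ x)) (hs : ∀ x, Γ' x (startTime hT) = x)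
    (hH' : ∀ x, IsHOne hT (Γ' x))
    (hθ : (θ : Measure (Curve d T)) = Measure.map Γ (m : Measure (Torus d)))
    (hμ : (μ : Measure (Curve d T)) = Measure.map Γ' (m : Measure (Torus d)))
    (hθc : HasFiniteCost hT H (θ : Measure (Curve d T)))
    (hμc : HasFiniteCost hT H (μ : Measure (Curve d T))) :
    realCost hT H f g η θ ≤ realCost hT H f g η μ := by
  have hemb := measurableEmbedding_of_start hm fun x => (hΓ x).start
  have hemb' := measurableEmbedding_of_start hm' hs
  have iθ := hθc.integrable.add (integrable_couplingCost hT hF hf hG hg η θ)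
  have iμ := hμc.integrable.add (integrable_couplingCost hT hF hf hG hg η μ)
  rw [realCost, realCost,
    ← integral_add hθc.integrable (integrable_couplingCost hT hF hf hG hg η θ),
    ← integral_add hμc.integrable (integrable_couplingCost hT hF hf hG hg η μ),
    hθ, hμ, hemb.integral_map, hemb'.integral_map]
  rw [hθ, hemb.integrable_map_iff] at iθ
  rw [hμ, hemb'.integrable_map_iff] at iμ
  refine integral_mono iθ iμ fun x => ?_
  have hle := (hΓ x).le (Γ' x) (hH' x) (hs x)
  rw [(hΓ x).isHOne.J_eq hH hF hf η, (hH' x).J_eq hH hF hf η] at hle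
  exact EReal.coe_le_coe_iff.1 hle

theorem realCost_mix {hT : 0 < T} (hF : IsMeasureDeriv F f) (hf : IsLipschitzIntoCk k f)
    (hG : IsMeasureDeriv G g) (hg : IsLipschitzIntoCk l g)
    {μ ν : ProbabilityMeasure (Curve d T)}
    (hμ : HasFiniteCost hT H (μ : Measure (Curve d T)))
    (hν : HasFiniteCost hT H (ν : Measure (Curve d T)))
    (η : ProbabilityMeasure (Curve d T)) (s : unitInterval) :
    realCost hT H f g η (mix s μ ν)
      = (1 - s) * realCost hT H f g η μ + s * realCost hT H f g η ν := by
  rw [realCost, realCost, realCost, integral_mix s hμ.integrable hν.integrable,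
    integral_mix s (integrable_couplingCost hT hF hf hG hg η μ)
      (integrable_couplingCost hT hF hf hG hg η ν)]
  ring

/-- The step `1 / (n + 1)` of the fictitious play. -/
def playStep (n : ℕ) : unitInterval :=
  ⟨1 / ((n : ℝ) + 1), by positivity, by
    rw [div_le_one (by positivity)]; linarith [n.cast_nonneg (α := ℝ)]⟩

namespace IsFictitiousPlay

variable {hT : 0 < T} {m₀ : PTorus d} {η θ : ℕ → ProbabilityMeasure (Curve d T)}

theorem belief_one (h : IsFictitiousPlay hT H f g m₀ η θ) : η 1 = θ 1 := by
  apply Subtype.ext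
  have := h.belief 0
  simp only [zero_add, Nat.cast_one, inv_one, Finset.Icc_self, Finset.sum_singleton,
    one_smul] at this
  exact this

theorem belief_succ (h : IsFictitiousPlay hT H f g m₀ η θ) {n : ℕ} (hn : 1 ≤ n) :
    η (n + 1) = mix (playStep n) (η n) (θ (n + 1)) := by
  obtain ⟨m, rfl⟩ := Nat.exists_eq_add_of_le' hn
  apply Subtype.ext
  change (η (m + 1 + 1) : Measure (Curve d T))
    = (mix (playStep (m + 1)) (η (m + 1)) (θ (m + 1 + 1)) : Measure (Curve d T))
  have hinv : ∀ j : ℕ, ((j + 1 : ℕ) : ℝ≥0∞)⁻¹ = ENNReal.ofReal (1 / ((j : ℝ) + 1)) := fun j => by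
    rw [one_div, ENNReal.ofReal_inv_of_pos (by positivity), ← Nat.cast_succ,
      ENNReal.ofReal_natCast]
  have hw : (0 : ℝ) ≤ 1 - playStep (m + 1) := by linarith [(playStep (m + 1)).2.2]
  rw [mix_apply, h.belief (m + 1), h.belief m, Finset.sum_Icc_succ_top (by omega), smul_add,
    smul_smul, hinv, hinv, ← ENNReal.ofReal_mul hw]
  -- What remains is the weight identity `(1 - 1/(m+2)) · 1/(m+1) = 1/(m+2)`.
  congr 3
  simp only [playStep]
  push_cast
  field_simp
  ring

/-- The induction starts at `η 1 = θ 1`: the arbitrary `η 0`, possibly of infinite cost, does not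
enter the averages. -/
theorem belief_induction (h : IsFictitiousPlay hT H f g m₀ η θ)
    {Q : ProbabilityMeasure (Curve d T) → Prop} (hθ : ∀ n, Q (θ (n + 1)))
    (hmix : ∀ (s : unitInterval) (μ ν), Q μ → Q ν → Q (mix s μ ν)) {n : ℕ} (hn : 1 ≤ n) :
    Q (η n) := by
  induction n, hn using Nat.le_induction with
  | base => rw [h.belief_one]; exact hθ 0
  | succ n hn ih => rw [h.belief_succ hn]; exact hmix _ _ _ ih (hθ n)

theorem hasFiniteCost_response (h : IsFictitiousPlay hT H f g m₀ η θ)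
    (hH : IsAdmissibleHamiltonian H) (hF : IsMeasureDeriv F f) (hf : IsLipschitzIntoCk k f)
    (hG : IsMeasureDeriv G g) (hg : IsLipschitzIntoCk l g) (n : ℕ) :
    HasFiniteCost hT H (θ (n + 1) : Measure (Curve d T)) := by
  obtain ⟨Γ, hm, hΓ, hθ⟩ := h.bestResponse n
  rw [hθ]
  exact hasFiniteCost_map_optimal hH hF hf hG hg hm hΓ m₀

theorem hasFiniteCost_belief (h : IsFictitiousPlay hT H f g m₀ η θ)
    (hH : IsAdmissibleHamiltonian H) (hF : IsMeasureDeriv F f) (hf : IsLipschitzIntoCk k f)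
    (hG : IsMeasureDeriv G g) (hg : IsLipschitzIntoCk l g) {n : ℕ} (hn : 1 ≤ n) :
    HasFiniteCost hT H (η n : Measure (Curve d T)) :=
  h.belief_induction (Q := fun μ => HasFiniteCost hT H (μ : Measure (Curve d T)))
    (h.hasFiniteCost_response hH hF hf hG hg) (fun s _ _ hμ hν => hμ.mix hν s) hn

theorem realCost_response_le (h : IsFictitiousPlay hT H f g m₀ η θ)
    (hH : IsAdmissibleHamiltonian H) (hF : IsMeasureDeriv F f) (hf : IsLipschitzIntoCk k f)
    (hG : IsMeasureDeriv G g) (hg : IsLipschitzIntoCk l g) {n : ℕ} (hn : 1 ≤ n) :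
    realCost hT H f g (η n) (θ (n + 1)) ≤ realCost hT H f g (η n) (η n) := by
  have hfin := h.hasFiniteCost_response hH hF hf hG hg
  -- The opponent `η n` stays fixed while the competitor `μ` runs over mixtures of best responses;
  -- the cost is affine in `μ`. Finiteness is carried along because affinity needs it.
  refine (h.belief_induction (Q := fun μ => HasFiniteCost hT H (μ : Measure (Curve d T)) ∧
    realCost hT H f g (η n) (θ (n + 1)) ≤ realCost hT H f g (η n) μ) (fun j => ⟨hfin j, ?_⟩)
    (fun s μ ν hμ hν => ⟨hμ.1.mix hν.1 s, ?_⟩) hn).2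
  · obtain ⟨Γ, hm, hΓ, hθ⟩ := h.bestResponse n
    obtain ⟨Γ', hm', hΓ', hθ'⟩ := h.bestResponse j
    exact realCost_le_of_optimal hH hF hf hG hg hm hm' hΓ (fun x => (hΓ' x).start)
      (fun x => (hΓ' x).isHOne) hθ hθ' (hfin n) (hfin j)
  · rw [realCost_mix hF hf hG hg hμ.1 hν.1]
    have h1 := mul_le_mul_of_nonneg_left hμ.2 (by linarith [s.2.2] : (0 : ℝ) ≤ 1 - s)
    have h2 := mul_le_mul_of_nonneg_left hν.2 s.2.1
    linarith

end IsFictitiousPlay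

end Play

end MFG

end

open MFG in
theorem proposition3p5 {d : ℕ} {T : ℝ} (hT : 0 < T)
    (H : Torus d → E d → ℝ) (hH : IsAdmissibleHamiltonian H)
    (f g : Torus d → PTorus d → ℝ) (hf : IsLipschitzIntoCk 2 f) (hg : IsLipschitzIntoCk 3 g)
    (F G : PTorus d → ℝ) (hF : IsMeasureDeriv F f) (hG : IsMeasureDeriv G g)
    (m₀ : PTorus d) (hm₀ : HasSmoothDensity m₀) :
    ∃ C : ℝ, 0 < C ∧ ∀ η θ : ℕ → MeasureTheory.ProbabilityMeasure (Curve d T),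
      IsFictitiousPlay hT H f g m₀ η θ → ∀ n : ℕ, 1 ≤ n →
        ∃ D : ℝ,
          HasDerivTowards (potential hT H F G) (η n) (θ (n + 1)) D ∧
          (D : EReal) = integralE (θ (n + 1) : MeasureTheory.Measure (Curve d T)) (J hT H f g (η n))
            - integralE (η n : MeasureTheory.Measure (Curve d T)) (J hT H f g (η n)) ∧
          D ≤ 0 ∧
          potential hT H F G (η (n + 1)) ≤ potential hT H F G (η n)
            + ((1 / ((n : ℝ) + 1) * D : ℝ) : EReal) + ((C / ((n : ℝ) + 1) ^ 2 : ℝ) : EReal) := by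
  obtain ⟨C, hC0, hC⟩ := exists_expansion_realPotential hT hF hf hG hg H
  -- The expansion constant may be `0`; adding `1` makes it positive.
  refine ⟨C + 1, by linarith, fun η θ h n hn => ?_⟩
  have hη := h.hasFiniteCost_belief hH hF hf hG hg hn
  have hθ := h.hasFiniteCost_response hH hF hf hG hg n
  have hexp := hC (η n) (θ (n + 1)) hη hθ
  refine ⟨realCost hT H f g (η n) (θ (n + 1)) - realCost hT H f g (η n) (η n),
    hasDerivTowards_potential hη hθ hexp, ?_,
    sub_nonpos.2 (h.realCost_response_le hH hF hf hG hg hn), ?_⟩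
  · rw [hθ.integralE_J_eq hH hF hf hG hg, hη.integralE_J_eq hH hF hf hG hg, EReal.coe_sub]
  · rw [h.belief_succ hn, (hη.mix hθ _).potential_eq, hη.potential_eq, ← EReal.coe_add,
      ← EReal.coe_add, EReal.coe_le_coe_iff]
    have h1 := (abs_le.1 (hexp (playStep n))).2
    have h2 : (playStep n : ℝ) = 1 / ((n : ℝ) + 1) := rfl
    rw [h2] at h1
    have h3 : C * (1 / ((n : ℝ) + 1)) ^ 2 ≤ (C + 1) / ((n : ℝ) + 1) ^ 2 := by
      rw [div_pow, one_pow, mul_one_div]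
      gcongr
      linarith
    linarith
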